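/- Let $U\subseteq\mathbb R^4$ be open, with coordinates $(t^1,t^2,t^3,t^4)=(x,y,u,v)$, and let $\theta$ be an arbitrary constant real skew-symmetric $4\times4$ matrix. Let $\mathcal A$ be the Moyal algebra: formal power series in $\hbar$ with coefficients in $C^\infty(U,\mathbb R)$, with the associative $\hbar$-bilinear product determined by $f*g=\sum_{p\ge0}\frac{\hbar^p}{p!}\,m\big((\sum_{i,j}\theta_{ij}\,\partial_i\otimes\partial_j)^p(f\otimes g)\big)$, where $m$ is pointwise multiplication; $\partial_i$ acts coefficientwise. For $X\in\mathcal A^m$ and a constant diagonal matrix $\eta$ put $E_i=\partial_iX$ (a row) and $g_{ij}=E_i*\eta (E_j)^t$. One calls $X$ a noncommutative space if the matrix $(g_{ij})$ is invertible over $\mathcal A$, with inverse $(g^{ij})$. Then (summing over repeated indices) let $\tilde E^i=\eta(E_j)^t*g^{ji}$, $e=\tilde E^j*E_j$, $\omega_i=-\partial_ie$, $\mathcal R_{ij}=\partial_i\omega_j-\partial_j\omega_i-(\omega_i*\omega_j-\omega_j*\omega_i)$, $R^l_{kij}=E_k*\mathcal R_{ij}*\tilde E^l$, $R_{ij}=R^p_{ipj}$,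 $R^i_j=g^{ik}*R_{kj}$, $R=g^{ji}*R_{ij}$ and $\Theta^l_p=g^{ik}*R^l_{kpi}$. The noncommutative vacuum Einstein equation is $R^i_j+\Theta^i_j-\delta^i_jR=0$ for all $i,j$. For $H\in\mathcal A$ with $\partial_vH=0$ (for instance a smooth function of $x,y,u$), let $$X_H=\Big(x,\;y,\;\tfrac{Hu+u+v}{\sqrt2},\;\tfrac{H-u^2/2}{\sqrt2},\;\tfrac{Hu-u+v}{\sqrt2},\;\tfrac{H+u^2/2}{\sqrt2}\Big),\qquad \eta=\mathrm{diag}(1,1,1,1,-1,-1),$$ where $Hu$ and $u^2$ are ordinary (pointwise) products. Then: 1. $X_H$ is a noncommutative space. 2. $R^4_3=\Theta^4_3=-H_{xx}-H_{yy}$ (upper index $4$, lower index $3$), and all other components $R^i_j$ and $\Theta^i_j$ vanish. 3. $X_H$ satisfies the noncommutative vacuum Einstein equation if and only if $H_{xx}+H_{yy}=0$. 4. Solutions are additive: if $\partial_vH_1=\partial_vH_2=0$ and $X_{H_1}$, $X_{H_2}$ are noncommutative spaces satisfying the vacuum Einstein equation, then so is $X_{H_1+H_2}$. -/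

import Mathlib

noncomputable section

namespace NCSpace

open scoped TensorProduct ContDiff
open TopologicalSpace

theorem two_le_infty : (2 : WithTop ℕ∞) ≤ ∞ :=
  WithTop.coe_le_coe.2 (le_top : ((2 : ℕ) : ℕ∞) ≤ ⊤)

section Smooth
variable {n : ℕ}

/-- Extension by zero to all of `ℝⁿ` of a function on an open set `U`. -/
def zeroExt (U : Opens (Fin n → ℝ)) (f : U → ℝ) : (Fin n → ℝ) → ℝ :=
  Function.extend Subtype.val f 0

theorem zeroExt_apply {U : Opens (Fin n → ℝ)} (f : U → ℝ) (t : U) : zeroExt U f t = f t :=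
  Subtype.val_injective.extend_apply f 0 t

theorem contDiffOn_zeroExt_of {U : Opens (Fin n → ℝ)} {f : U → ℝ} {F : (Fin n → ℝ) → ℝ}
    (hF : ContDiffOn ℝ ∞ F U) (h : ∀ t : U, f t = F t) : ContDiffOn ℝ ∞ (zeroExt U f) U :=
  hF.congr fun t ht => by rw [← h ⟨t, ht⟩]; exact zeroExt_apply f ⟨t, ht⟩

/-- The algebra of real smooth functions on the open set `U` of `ℝⁿ`. -/
def SmoothFun (U : Opens (Fin n → ℝ)) : Subalgebra ℝ (U → ℝ) where
  carrier := {f | ContDiffOn ℝ ∞ (zeroExt U f) U}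
  mul_mem' hf hg := contDiffOn_zeroExt_of (hf.mul hg) fun t => by
    simp only [Pi.mul_apply, zeroExt_apply]
  add_mem' hf hg := contDiffOn_zeroExt_of (hf.add hg) fun t => by
    simp only [Pi.add_apply, zeroExt_apply]
  algebraMap_mem' r := contDiffOn_zeroExt_of (F := fun _ => r) contDiffOn_const fun t => rfl

namespace SmoothFun
variable {U : Opens (Fin n → ℝ)}

/-- The coordinate function `tⁱ`. -/
def coord (U : Opens (Fin n → ℝ)) (i : Fin n) : SmoothFun U :=
  ⟨fun t => t.1 i, contDiffOn_zeroExt_of (F := fun t => t i) (contDiff_apply ℝ ℝ i).contDiffOn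
    fun _ => rfl⟩

theorem hasFDerivAt_of_eq {f : SmoothFun U} {F : (Fin n → ℝ) → ℝ} {t : U}
    {F' : (Fin n → ℝ) →L[ℝ] ℝ}
    (h : ∀ s : U, f.1 s = F s) (hF : HasFDerivAt F F' t) : HasFDerivAt (zeroExt U f.1) F' t :=
  hF.congr_of_eventuallyEq <| by
    filter_upwards [U.isOpen.mem_nhds t.2] with s hs
    rw [← h ⟨s, hs⟩]; exact zeroExt_apply f.1 ⟨s, hs⟩

theorem hasFDerivAt (f : SmoothFun U) (t : U) :
    HasFDerivAt (zeroExt U f.1) (fderiv ℝ (zeroExt U f.1) t) t :=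
  ((f.2.contDiffAt (U.isOpen.mem_nhds t.2)).differentiableAt (by simp)).hasFDerivAt

/-- The partial derivative `∂f/∂tⁱ`. -/
def pderivFun (i : Fin n) (f : SmoothFun U) : SmoothFun U :=
  ⟨fun t => fderiv ℝ (zeroExt U f.1) t (Pi.single i 1),
    contDiffOn_zeroExt_of (F := fun t => fderiv ℝ (zeroExt U f.1) t (Pi.single i 1))
      ((f.2.fderiv_of_isOpen U.isOpen (by simp)).clm_apply contDiffOn_const) fun _ => rfl⟩

/-- The partial derivative `∂/∂tⁱ`, as a derivation. -/
def pderiv (i : Fin n) : Derivation ℝ (SmoothFun U) (SmoothFun U) :=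
  Derivation.mk'
    { toFun := pderivFun i
      map_add' := fun f g => Subtype.ext <| funext fun t => by
        have := (hasFDerivAt_of_eq (f := f + g) (fun s => by simp [zeroExt_apply])
          ((hasFDerivAt f t).add (hasFDerivAt g t))).fderiv
        simp only [pderivFun, this]; rfl
      map_smul' := fun c f => Subtype.ext <| funext fun t => by
        have := (hasFDerivAt_of_eq (f := c • f) (fun s => by simp [zeroExt_apply])
          ((hasFDerivAt f t).const_smul c)).fderiv
        simp only [pderivFun, this]; rfl }
    fun f g => Subtype.ext <| funext fun t => by
      have := (hasFDerivAt_of_eq (f := f * g) (fun s => by simp [zeroExt_apply])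
          ((hasFDerivAt f t).mul (hasFDerivAt g t))).fderiv
      change fderiv ℝ (zeroExt U (f * g).1) t (Pi.single i 1) = _
      rw [this]; simp [zeroExt_apply, pderivFun]

theorem pderiv_apply (i : Fin n) (f : SmoothFun U) (t : U) :
    (pderiv i f).1 t = fderiv ℝ (zeroExt U f.1) t (Pi.single i 1) := rfl

theorem pderiv_comm (i j : Fin n) (f : SmoothFun U) :
    pderiv i (pderiv j f) = pderiv j (pderiv i f) := Subtype.ext <| funext fun t => by
  have hc := f.2.contDiffAt (U.isOpen.mem_nhds t.2)
  have hd : DifferentiableAt ℝ (fderiv ℝ (zeroExt U f.1)) t :=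
    (hc.fderiv_right (m := 1) (by exact_mod_cast two_le_infty)).differentiableAt (by simp)
  have key : ∀ k l : Fin n, (pderiv k (pderiv l f)).1 t =
      fderiv ℝ (fderiv ℝ (zeroExt U f.1)) t (Pi.single k 1) (Pi.single l 1) := fun k l => by
    rw [pderiv_apply, (hasFDerivAt_of_eq (fun s => pderiv_apply l f s)
      (hd.hasFDerivAt.clm_apply (hasFDerivAt_const _ _))).fderiv]
    simp
  rw [key, key]
  exact (hc.isSymmSndFDerivAt (by simpa using two_le_infty)).eq _ _

end SmoothFun
end Smooth

section Abstract
open Finset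
variable {n : ℕ} {S : Type*} [CommRing S] [Algebra ℝ S]

/-- The bidifferential operator `∑ i j, θ i j ∂ᵢ ⊗ ∂ⱼ`. -/
def bidiff (θ : Matrix (Fin n) (Fin n) ℝ) (D : Fin n → Derivation ℝ S S) :
    Module.End ℝ (S ⊗[ℝ] S) :=
  ∑ i, ∑ j, θ i j • TensorProduct.map (D i).toLinearMap (D j).toLinearMap

/-- The map `μ_p (f, g) = (1 / p!) (∑ i j, θ i j ∂ᵢ ⊗ ∂ⱼ)ᵖ (f ⊗ g)` followed by restriction to the
diagonal, that is, by pointwise multiplication. -/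
def moyalTerm (θ : Matrix (Fin n) (Fin n) ℝ) (D : Fin n → Derivation ℝ S S) (p : ℕ) :
    S →ₗ[ℝ] S →ₗ[ℝ] S :=
  (p.factorial : ℝ)⁻¹ • (TensorProduct.mk ℝ S S).compr₂ (LinearMap.mul' ℝ S ∘ₗ bidiff θ D ^ p)

theorem moyalTerm_apply (θ : Matrix (Fin n) (Fin n) ℝ) (D : Fin n → Derivation ℝ S S) (p : ℕ)
    (f g : S) : moyalTerm θ D p f g =
      (p.factorial : ℝ)⁻¹ • LinearMap.mul' ℝ S ((bidiff θ D ^ p) (f ⊗ₜ[ℝ] g)) := rfl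

variable (θ : Matrix (Fin n) (Fin n) ℝ) (D : Fin n → Derivation ℝ S S)

/-- The operator by which `∑ i j, θ i j ∂ᵢ ⊗ ∂ⱼ` acts after multiplying the first two factors. -/
def bidiffL : Module.End ℝ ((S ⊗[ℝ] S) ⊗[ℝ] S) :=
  ∑ i, ∑ j, θ i j • TensorProduct.map
    ((D i).toLinearMap.rTensor S + (D i).toLinearMap.lTensor S) (D j).toLinearMap

/-- The operator by which `∑ i j, θ i j ∂ᵢ ⊗ ∂ⱼ` acts after multiplying the last two factors. -/
def bidiffR : Module.End ℝ (S ⊗[ℝ] (S ⊗[ℝ] S)) :=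
  ∑ i, ∑ j, θ i j • TensorProduct.map (D i).toLinearMap
    ((D j).toLinearMap.rTensor S + (D j).toLinearMap.lTensor S)

theorem bidiff_mulL (p : ℕ) (x : (S ⊗[ℝ] S) ⊗[ℝ] S) :
    (bidiff θ D ^ p) ((LinearMap.mul' ℝ S).rTensor S x) =
      (LinearMap.mul' ℝ S).rTensor S ((bidiffL θ D ^ p) x) := by
  have h : bidiff θ D ∘ₗ (LinearMap.mul' ℝ S).rTensor S =
      (LinearMap.mul' ℝ S).rTensor S ∘ₗ bidiffL θ D := by
    ext a b c
    simp [bidiff, bidiffL, TensorProduct.add_tmul, mul_comm, add_comm]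
  induction p generalizing x with
  | zero => rfl
  | succ p ih => rw [pow_succ, pow_succ, Module.End.mul_apply, Module.End.mul_apply, ← ih]
                 exact congrArg _ (LinearMap.congr_fun h x)

theorem bidiff_mulR (p : ℕ) (x : S ⊗[ℝ] (S ⊗[ℝ] S)) :
    (bidiff θ D ^ p) ((LinearMap.mul' ℝ S).lTensor S x) =
      (LinearMap.mul' ℝ S).lTensor S ((bidiffR θ D ^ p) x) := by
  have h : bidiff θ D ∘ₗ (LinearMap.mul' ℝ S).lTensor S =
      (LinearMap.mul' ℝ S).lTensor S ∘ₗ bidiffR θ D := by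
    ext a b c
    simp [bidiff, bidiffR, TensorProduct.tmul_add, mul_comm, add_comm]
  induction p generalizing x with
  | zero => rfl
  | succ p ih => rw [pow_succ, pow_succ, Module.End.mul_apply, Module.End.mul_apply, ← ih]
                 exact congrArg _ (LinearMap.congr_fun h x)

theorem rTensor_pow_tmul (P : Module.End ℝ (S ⊗[ℝ] S)) (q : ℕ) (x : S ⊗[ℝ] S) (c : S) :
    ((P ^ q) x) ⊗ₜ[ℝ] c = ((P.rTensor S) ^ q) (x ⊗ₜ c) := by
  rw [LinearMap.rTensor_pow]; rfl

theorem lTensor_pow_tmul (P : Module.End ℝ (S ⊗[ℝ] S)) (q : ℕ) (x : S ⊗[ℝ] S) (c : S) :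
    c ⊗ₜ[ℝ] ((P ^ q) x) = ((P.lTensor S) ^ q) (c ⊗ₜ x) := by
  rw [LinearMap.lTensor_pow]; rfl

theorem bidiffL_commute (hD : ∀ i j a, D i (D j a) = D j (D i a)) :
    Commute (bidiffL θ D) ((bidiff θ D).rTensor S) := by
  have h : (bidiff θ D).rTensor S = ∑ i, ∑ j, θ i j •
      (TensorProduct.map (D i).toLinearMap (D j).toLinearMap).rTensor S := by
    ext a b c
    simp [bidiff, TensorProduct.sum_tmul, TensorProduct.smul_tmul']
  rw [h, bidiffL]
  refine Commute.sum_left _ _ _ fun i _ => Commute.sum_left _ _ _ fun j _ =>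
    Commute.smul_left (Commute.sum_right _ _ _ fun k _ => Commute.sum_right _ _ _ fun l _ =>
      Commute.smul_right ?_ _) _
  change _ * _ = _ * _
  ext a b c
  simp [hD, TensorProduct.add_tmul]

theorem bidiffR_commute (hD : ∀ i j a, D i (D j a) = D j (D i a)) :
    Commute (bidiffR θ D) ((bidiff θ D).lTensor S) := by
  have h : (bidiff θ D).lTensor S = ∑ i, ∑ j, θ i j •
      (TensorProduct.map (D i).toLinearMap (D j).toLinearMap).lTensor S := by
    ext a b c
    simp [bidiff, TensorProduct.tmul_sum]
  rw [h, bidiffR]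
  refine Commute.sum_left _ _ _ fun i _ => Commute.sum_left _ _ _ fun j _ =>
    Commute.smul_left (Commute.sum_right _ _ _ fun k _ => Commute.sum_right _ _ _ fun l _ =>
      Commute.smul_right ?_ _) _
  change _ * _ = _ * _
  ext a b c
  simp [hD, TensorProduct.tmul_add]

theorem bidiff_assoc (p : ℕ) (a b c : S) :
    TensorProduct.assoc ℝ S S S
        (((bidiffL θ D + (bidiff θ D).rTensor S) ^ p) (a ⊗ₜ b ⊗ₜ c)) =
      ((bidiffR θ D + (bidiff θ D).lTensor S) ^ p) (a ⊗ₜ (b ⊗ₜ c)) := by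
  have h : (TensorProduct.assoc ℝ S S S).toLinearMap ∘ₗ
      (bidiffL θ D + (bidiff θ D).rTensor S) =
      (bidiffR θ D + (bidiff θ D).lTensor S) ∘ₗ (TensorProduct.assoc ℝ S S S).toLinearMap := by
    ext a b c
    simp [bidiff, bidiffL, bidiffR, TensorProduct.tmul_add, TensorProduct.add_tmul,
      TensorProduct.sum_tmul, TensorProduct.tmul_sum, Finset.sum_add_distrib,
      TensorProduct.smul_tmul']
    simp only [← TensorProduct.smul_tmul', TensorProduct.tmul_smul]
    abel
  suffices H : ∀ x, TensorProduct.assoc ℝ S S S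
        (((bidiffL θ D + (bidiff θ D).rTensor S) ^ p) x) =
      ((bidiffR θ D + (bidiff θ D).lTensor S) ^ p) (TensorProduct.assoc ℝ S S S x) from
    H (a ⊗ₜ b ⊗ₜ c)
  induction p with
  | zero => intro x; rfl
  | succ p ih =>
    intro x
    rw [pow_succ, pow_succ, Module.End.mul_apply, Module.End.mul_apply, ih]
    exact congrArg _ (LinearMap.congr_fun h x)

/-- The `ℏⁿ`-coefficient of `(a * b) * c` for `a b c : S`. -/
def moyalTriple (N : ℕ) (a b c : S) : S :=
  (N.factorial : ℝ)⁻¹ • LinearMap.mul' ℝ S ((LinearMap.mul' ℝ S).rTensor S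
    (((bidiffL θ D + (bidiff θ D).rTensor S) ^ N) (a ⊗ₜ b ⊗ₜ c)))

theorem divPow_add {A : Type*} [Ring A] [Algebra ℝ A] {x y : A} (h : Commute x y) (N : ℕ) :
    (N.factorial : ℝ)⁻¹ • (x + y) ^ N = ∑ k ∈ antidiagonal N,
      ((k.1.factorial : ℝ)⁻¹ * (k.2.factorial : ℝ)⁻¹) • (x ^ k.1 * y ^ k.2) := by
  rw [h.add_pow', Finset.smul_sum]
  refine Finset.sum_congr rfl fun k hk => ?_
  rw [← Nat.cast_smul_eq_nsmul ℝ, smul_smul]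
  congr 1
  rw [HasAntidiagonal.mem_antidiagonal] at hk
  subst hk
  have := Nat.add_choose_mul_factorial_mul_factorial k.1 k.2
  have h1 : ((k.1 + k.2).factorial : ℝ) ≠ 0 := by positivity
  rw [inv_mul_eq_div, div_eq_iff h1, ← this]
  have h2 : (k.1.factorial : ℝ) ≠ 0 := by positivity
  have h3 : (k.2.factorial : ℝ) ≠ 0 := by positivity
  rw [Nat.choose_symm_add]
  push_cast
  field_simp

theorem moyalTriple_left (hD : ∀ i j a, D i (D j a) = D j (D i a)) (N : ℕ) (a b c : S) :
    ∑ k ∈ antidiagonal N, moyalTerm θ D k.1 (moyalTerm θ D k.2 a b) c =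
      moyalTriple θ D N a b c := by
  have h := congrArg (fun T : Module.End ℝ ((S ⊗[ℝ] S) ⊗[ℝ] S) =>
    LinearMap.mul' ℝ S ((LinearMap.mul' ℝ S).rTensor S (T (a ⊗ₜ b ⊗ₜ c))))
    (divPow_add (bidiffL_commute θ D hD) N)
  simp only [LinearMap.smul_apply, map_smul, LinearMap.sum_apply, map_sum] at h
  rw [moyalTriple, h]
  refine Finset.sum_congr rfl fun k _ => ?_
  rw [Module.End.mul_apply, ← bidiff_mulL, ← rTensor_pow_tmul, LinearMap.rTensor_tmul, mul_smul]
  rw [moyalTerm_apply θ D k.2, moyalTerm_apply, ← TensorProduct.smul_tmul', map_smul, map_smul]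

theorem moyalTriple_right (hD : ∀ i j a, D i (D j a) = D j (D i a)) (N : ℕ) (a b c : S) :
    ∑ k ∈ antidiagonal N, moyalTerm θ D k.1 a (moyalTerm θ D k.2 b c) =
      moyalTriple θ D N a b c := by
  have h := congrArg (fun T : Module.End ℝ (S ⊗[ℝ] (S ⊗[ℝ] S)) =>
    LinearMap.mul' ℝ S ((LinearMap.mul' ℝ S).lTensor S (T (a ⊗ₜ (b ⊗ₜ c)))))
    (divPow_add (bidiffR_commute θ D hD) N)
  simp only [LinearMap.smul_apply, map_smul, LinearMap.sum_apply, map_sum] at h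
  have e : ∀ x, LinearMap.mul' ℝ S ((LinearMap.mul' ℝ S).rTensor S x) =
      LinearMap.mul' ℝ S ((LinearMap.mul' ℝ S).lTensor S (TensorProduct.assoc ℝ S S S x)) := by
    intro x
    have : LinearMap.mul' ℝ S ∘ₗ (LinearMap.mul' ℝ S).rTensor S =
      LinearMap.mul' ℝ S ∘ₗ (LinearMap.mul' ℝ S).lTensor S ∘ₗ
        (TensorProduct.assoc ℝ S S S).toLinearMap := by
      ext a b c; simp [mul_assoc]
    exact LinearMap.congr_fun this x
  rw [moyalTriple, e, bidiff_assoc, h]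
  refine Finset.sum_congr rfl fun k _ => ?_
  rw [Module.End.mul_apply, ← bidiff_mulR, ← lTensor_pow_tmul, LinearMap.lTensor_tmul, mul_smul]
  simp only [moyalTerm_apply, map_smul]
  rw [smul_comm]

theorem moyalTerm_zero (f g : S) : moyalTerm θ D 0 f g = f * g := by
  simp [moyalTerm_apply]

theorem moyalTerm_one_left (p : ℕ) (g : S) : moyalTerm θ D (p + 1) 1 g = 0 := by
  have : bidiff θ D (1 ⊗ₜ g) = 0 := by simp [bidiff]
  rw [moyalTerm_apply, pow_succ, Module.End.mul_apply, this]; simp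

theorem moyalTerm_one_right (p : ℕ) (f : S) : moyalTerm θ D (p + 1) f 1 = 0 := by
  have : bidiff θ D (f ⊗ₜ 1) = 0 := by simp [bidiff]
  rw [moyalTerm_apply, pow_succ, Module.End.mul_apply, this]; simp

/-- The star product on formal power series in `ℏ` (given by their coefficient sequences):
`(∑ f_a ℏᵃ) * (∑ g_b ℏᵇ) = ∑ μ_p (f_a, g_b) ℏᵖ⁺ᵃ⁺ᵇ`. -/
def moyalProd (f g : ℕ → S) : ℕ → S := fun N =>
  ∑ x ∈ antidiagonal N, ∑ y ∈ antidiagonal x.2, moyalTerm θ D x.1 (f y.1) (g y.2)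

theorem moyalProd_one (f : ℕ → S) : moyalProd θ D f (Pi.single 0 1) = f := by
  funext N
  unfold moyalProd
  rw [sum_eq_single (0, N), sum_eq_single (N, 0)]
  · simp [moyalTerm_zero]
  · rintro ⟨a, b⟩ h h'
    have : b ≠ 0 := by rintro rfl; simp at h h'; omega
    simp [this]
  · simp
  · rintro ⟨p, r⟩ h h'
    obtain _ | p := p
    · simp at h h'; omega
    · refine sum_eq_zero fun y _ => ?_
      by_cases hy : y.2 = 0
      · simp [hy, moyalTerm_one_right]
      · simp [hy]
  · simp

theorem one_moyalProd (f : ℕ → S) : moyalProd θ D (Pi.single 0 1) f = f := by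
  funext N
  unfold moyalProd
  rw [sum_eq_single (0, N), sum_eq_single (0, N)]
  · simp [moyalTerm_zero]
  · rintro ⟨a, b⟩ h h'
    have : a ≠ 0 := by rintro rfl; simp at h h'; omega
    simp [this]
  · simp
  · rintro ⟨p, r⟩ h h'
    obtain _ | p := p
    · simp at h h'; omega
    · refine sum_eq_zero fun y _ => ?_
      by_cases hy : y.1 = 0
      · simp [hy, moyalTerm_one_left]
      · simp [hy]
  · simp

theorem moyalProd_moyalProd_left (hD : ∀ i j a, D i (D j a) = D j (D i a)) (f g h : ℕ → S)
    (N : ℕ) : moyalProd θ D (moyalProd θ D f g) h N =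
    ∑ x ∈ antidiagonal N, ∑ y ∈ antidiagonal x.2, ∑ z ∈ antidiagonal y.2,
      moyalTriple θ D x.1 (f y.1) (g z.1) (h z.2) := by
  simp only [moyalProd, map_sum, LinearMap.sum_apply, ← moyalTriple_left θ D hD, sum_sigma']
  refine sum_nbij'
    (fun x => ⟨(x.1.1 + x.2.2.1.1, x.2.2.2.1 + x.2.2.2.2 + x.2.1.2),
      (x.2.2.2.1, x.2.2.2.2 + x.2.1.2), (x.2.2.2.2, x.2.1.2), (x.1.1, x.2.2.1.1)⟩)
    (fun x => ⟨(x.2.2.2.1, x.2.2.2.2 + x.2.1.1 + x.2.2.1.1 + x.2.2.1.2),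
      (x.2.2.2.2 + x.2.1.1 + x.2.2.1.1, x.2.2.1.2),
      (x.2.2.2.2, x.2.1.1 + x.2.2.1.1), (x.2.1.1, x.2.2.1.1)⟩) ?_ ?_ ?_ ?_ ?_
  rotate_right
  · intro x _; rfl
  all_goals
    rintro ⟨⟨p, r⟩, ⟨k, c⟩, ⟨q, s⟩, ⟨a, b⟩⟩ hx
    simp only [mem_sigma, HasAntidiagonal.mem_antidiagonal] at hx ⊢
    obtain ⟨h1, h2, h3, h4⟩ := hx
    subst h4 h3 h2 h1
  · refine ⟨?_, ?_, ?_, ?_⟩ <;> first | trivial | ring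
  · refine ⟨?_, ?_, ?_, ?_⟩ <;> first | trivial | ring
  · simp [add_assoc]
  · simp [add_assoc]

theorem moyalProd_moyalProd_right (hD : ∀ i j a, D i (D j a) = D j (D i a)) (f g h : ℕ → S)
    (N : ℕ) : moyalProd θ D f (moyalProd θ D g h) N =
    ∑ x ∈ antidiagonal N, ∑ y ∈ antidiagonal x.2, ∑ z ∈ antidiagonal y.2,
      moyalTriple θ D x.1 (f y.1) (g z.1) (h z.2) := by
  simp only [moyalProd, map_sum, ← moyalTriple_right θ D hD, sum_sigma']
  refine sum_nbij'
    (fun x => ⟨(x.1.1 + x.2.2.1.1, x.2.1.1 + (x.2.2.2.1 + x.2.2.2.2)),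
      (x.2.1.1, x.2.2.2.1 + x.2.2.2.2), (x.2.2.2.1, x.2.2.2.2), (x.1.1, x.2.2.1.1)⟩)
    (fun x => ⟨(x.2.2.2.1, x.2.1.1 + (x.2.2.2.2 + (x.2.2.1.1 + x.2.2.1.2))),
      (x.2.1.1, x.2.2.2.2 + (x.2.2.1.1 + x.2.2.1.2)),
      (x.2.2.2.2, x.2.2.1.1 + x.2.2.1.2), (x.2.2.1.1, x.2.2.1.2)⟩) ?_ ?_ ?_ ?_ ?_
  rotate_right
  · intro x _; rfl
  all_goals
    rintro ⟨⟨p, r⟩, ⟨k, c⟩, ⟨q, s⟩, ⟨a, b⟩⟩ hx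
    simp only [mem_sigma, HasAntidiagonal.mem_antidiagonal] at hx ⊢
    obtain ⟨h1, h2, h3, h4⟩ := hx
    subst h4 h3 h2 h1
  · refine ⟨?_, ?_, ?_, ?_⟩ <;> first | trivial | ring
  · refine ⟨?_, ?_, ?_, ?_⟩ <;> first | trivial | ring
  · simp
  · simp

theorem moyalProd_add (f g h : ℕ → S) :
    moyalProd θ D f (g + h) = moyalProd θ D f g + moyalProd θ D f h := by
  funext N; simp [moyalProd, sum_add_distrib]

theorem add_moyalProd (f g h : ℕ → S) :
    moyalProd θ D (f + g) h = moyalProd θ D f h + moyalProd θ D g h := by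
  funext N; simp [moyalProd, sum_add_distrib]

theorem moyalProd_zero (f : ℕ → S) : moyalProd θ D f 0 = 0 := by
  funext N; simp [moyalProd]

theorem zero_moyalProd (f : ℕ → S) : moyalProd θ D 0 f = 0 := by
  funext N; simp [moyalProd]

end Abstract

section Moyal
variable {n : ℕ}

/-- The Moyal algebra: formal power series `∑ f_q ℏ^q` whose coefficients `f_q` are real smooth
functions on `U`, stored as the sequence `q ↦ f_q`, with the star product defined by `θ`. -/
def MoyalAlgebra (U : Opens (Fin n → ℝ)) (_θ : Matrix (Fin n) (Fin n) ℝ) : Type :=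
  ℕ → SmoothFun U

namespace MoyalAlgebra
variable {U : Opens (Fin n → ℝ)} {θ : Matrix (Fin n) (Fin n) ℝ}

instance : AddCommGroup (MoyalAlgebra U θ) := inferInstanceAs (AddCommGroup (ℕ → SmoothFun U))

instance : Module ℝ (MoyalAlgebra U θ) := inferInstanceAs (Module ℝ (ℕ → SmoothFun U))

/-- A smooth function as a series constant in `ℏ`. -/
def ofSmooth (f : SmoothFun U) : MoyalAlgebra U θ := Pi.single 0 f

/-- The star product. -/
instance : Mul (MoyalAlgebra U θ) := ⟨fun f g => moyalProd θ SmoothFun.pderiv f g⟩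

instance : One (MoyalAlgebra U θ) := ⟨ofSmooth 1⟩

theorem mul_assoc_aux (f g h : MoyalAlgebra U θ) : f * g * h = f * (g * h) := by
  refine funext fun N => ?_
  have hl := moyalProd_moyalProd_left θ SmoothFun.pderiv (SmoothFun.pderiv_comm (U := U)) f g h N
  have hr := moyalProd_moyalProd_right θ SmoothFun.pderiv (SmoothFun.pderiv_comm (U := U)) f g h N
  exact hl.trans hr.symm

theorem one_mul_aux (f : MoyalAlgebra U θ) : 1 * f = f :=
  one_moyalProd θ (SmoothFun.pderiv (U := U)) f

theorem mul_one_aux (f : MoyalAlgebra U θ) : f * 1 = f :=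
  moyalProd_one θ (SmoothFun.pderiv (U := U)) f

theorem left_distrib_aux (f g h : MoyalAlgebra U θ) : f * (g + h) = f * g + f * h :=
  moyalProd_add θ (SmoothFun.pderiv (U := U)) f g h

theorem right_distrib_aux (f g h : MoyalAlgebra U θ) : (f + g) * h = f * h + g * h :=
  add_moyalProd θ (SmoothFun.pderiv (U := U)) f g h

theorem zero_mul_aux (f : MoyalAlgebra U θ) : 0 * f = 0 :=
  zero_moyalProd θ (SmoothFun.pderiv (U := U)) f

theorem mul_zero_aux (f : MoyalAlgebra U θ) : f * 0 = 0 :=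
  moyalProd_zero θ (SmoothFun.pderiv (U := U)) f

/-- The Moyal algebra is an associative unital ring with the star product as multiplication. -/
instance : Ring (MoyalAlgebra U θ) where
  __ := (inferInstance : AddCommGroup (MoyalAlgebra U θ))
  __ := (inferInstance : Mul (MoyalAlgebra U θ))
  __ := (inferInstance : One (MoyalAlgebra U θ))
  mul_assoc := mul_assoc_aux
  one_mul := one_mul_aux
  mul_one := mul_one_aux
  left_distrib := left_distrib_aux
  right_distrib := right_distrib_aux
  zero_mul := zero_mul_aux
  mul_zero := mul_zero_aux

/-- The commutative, `ℏ`-bilinear extension of the pointwise product of functions. -/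
def pointwiseMul (f g : MoyalAlgebra U θ) : MoyalAlgebra U θ :=
  fun q => ∑ x ∈ Finset.HasAntidiagonal.antidiagonal q, f x.1 * g x.2

/-- The coordinate function `tⁱ` as an element of the Moyal algebra. -/
def coord (i : Fin n) : MoyalAlgebra U θ := ofSmooth (SmoothFun.coord U i)

/-- The partial derivative `∂ᵢ`, acting on each coefficient. -/
def pderiv (i : Fin n) : MoyalAlgebra U θ →ₗ[ℝ] MoyalAlgebra U θ where
  toFun f := fun q => SmoothFun.pderiv i (f q)
  map_add' f g := funext fun q => map_add (SmoothFun.pderiv i) (f q) (g q)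
  map_smul' c f := funext fun q => (SmoothFun.pderiv i).map_smul c (f q)

end MoyalAlgebra
end Moyal

section Embedded

variable {n m : ℕ} {U : Opens (Fin n → ℝ)} {θ : Matrix (Fin n) (Fin n) ℝ}

/-! In this section `X` is an `m`-tuple of elements of the Moyal algebra, and `η` is the diagonal
of the constant diagonal `m × m` matrix that gives the signature. -/

/-- The matrix whose rows are `Eᵢ = ∂ᵢ X`. -/
def frame (X : Fin m → MoyalAlgebra U θ) : Matrix (Fin n) (Fin m) (MoyalAlgebra U θ) :=
  Matrix.of fun i α => MoyalAlgebra.pderiv i (X α)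

/-- The matrix whose columns are `η (Eᵢ)ᵗ`. -/
def frameT (η : Fin m → ℝ) (X : Fin m → MoyalAlgebra U θ) :
    Matrix (Fin m) (Fin n) (MoyalAlgebra U θ) :=
  Matrix.of fun α i => η α • MoyalAlgebra.pderiv i (X α)

/-- The metric `g i j = ∑ α, ∂ᵢ X^α * η_αα * ∂ⱼ X^α`. -/
def metric (η : Fin m → ℝ) (X : Fin m → MoyalAlgebra U θ) :
    Matrix (Fin n) (Fin n) (MoyalAlgebra U θ) :=
  frame X * frameT η X

/-- `X` is an embedded noncommutative space if its metric is an invertible matrix over the Moyal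
algebra. -/
def IsNCSpace (η : Fin m → ℝ) (X : Fin m → MoyalAlgebra U θ) : Prop :=
  IsUnit (metric η X)

/-- The inverse metric `gⁱʲ` (which is zero if `X` is not a noncommutative space). -/
def invMetric (η : Fin m → ℝ) (X : Fin m → MoyalAlgebra U θ) :
    Matrix (Fin n) (Fin n) (MoyalAlgebra U θ) :=
  Ring.inverse (metric η X)

/-- The matrix whose columns are `Ẽⁱ = ∑ j, η (Eⱼ)ᵗ * gʲⁱ`. -/
def dualFrame (η : Fin m → ℝ) (X : Fin m → MoyalAlgebra U θ) :
    Matrix (Fin m) (Fin n) (MoyalAlgebra U θ) :=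
  frameT η X * invMetric η X

/-- The idempotent `e = ∑ j, Ẽʲ * Eⱼ` defining the left and right tangent bundles. -/
def idempotent (η : Fin m → ℝ) (X : Fin m → MoyalAlgebra U θ) :
    Matrix (Fin m) (Fin m) (MoyalAlgebra U θ) :=
  dualFrame η X * frame X

/-- The canonical connection `ωᵢ = - ∂ᵢ e`, for which `∇ᵢ ζ = ∂ᵢ ζ + ζ * ωᵢ`. -/
def connection (η : Fin m → ℝ) (X : Fin m → MoyalAlgebra U θ) (i : Fin n) :
    Matrix (Fin m) (Fin m) (MoyalAlgebra U θ) :=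
  -(idempotent η X).map (MoyalAlgebra.pderiv i)

/-- The curvature `∂ᵢ ωⱼ - ∂ⱼ ωᵢ - (ωᵢ * ωⱼ - ωⱼ * ωᵢ)` of the canonical connection. -/
def curvature (η : Fin m → ℝ) (X : Fin m → MoyalAlgebra U θ) (i j : Fin n) :
    Matrix (Fin m) (Fin m) (MoyalAlgebra U θ) :=
  (connection η X j).map (MoyalAlgebra.pderiv i) - (connection η X i).map (MoyalAlgebra.pderiv j)
    - (connection η X i * connection η X j - connection η X j * connection η X i)

/-- The Riemannian curvature `R^l_{k i j} = E_k * ℛ_{i j} * Ẽ^l`. -/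
def riemann (η : Fin m → ℝ) (X : Fin m → MoyalAlgebra U θ) (l k i j : Fin n) :
    MoyalAlgebra U θ :=
  (frame X * curvature η X i j * dualFrame η X) k l

/-- The Ricci curvature `R_{i j} = ∑ p, R^p_{i p j}`. -/
def ricci (η : Fin m → ℝ) (X : Fin m → MoyalAlgebra U θ) (i j : Fin n) : MoyalAlgebra U θ :=
  ∑ p, riemann η X p i p j

/-- The scalar curvature `R = ∑ i j, gʲⁱ * R_{i j}`. -/
def scalarCurvature (η : Fin m → ℝ) (X : Fin m → MoyalAlgebra U θ) : MoyalAlgebra U θ :=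
  ∑ i, ∑ j, invMetric η X j i * ricci η X i j

/-- `R^i_j = ∑ k, gⁱᵏ * R_{k j}`. -/
def ricciMixed (η : Fin m → ℝ) (X : Fin m → MoyalAlgebra U θ) (i j : Fin n) :
    MoyalAlgebra U θ :=
  ∑ k, invMetric η X i k * ricci η X k j

/-- `Θ^l_p = ∑ i k, gⁱᵏ * R^l_{k p i}`. -/
def thetaMixed (η : Fin m → ℝ) (X : Fin m → MoyalAlgebra U θ) (l p : Fin n) :
    MoyalAlgebra U θ :=
  ∑ i, ∑ k, invMetric η X i k * riemann η X l k p i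

/-- The noncommutative vacuum Einstein equation `R^i_j + Θ^i_j - δ^i_j R = 0`. -/
def VacuumEinstein (η : Fin m → ℝ) (X : Fin m → MoyalAlgebra U θ) : Prop :=
  ∀ i j, ricciMixed η X i j + thetaMixed η X i j - (if i = j then scalarCurvature η X else 0) = 0

end Embedded

section PlaneFronted

/-! The coordinates `(x, y, u, v)` on `ℝ⁴` have the indices `0, 1, 2, 3`. -/

variable {U : Opens (Fin 4 → ℝ)} {θ : Matrix (Fin 4) (Fin 4) ℝ}

/-- The diagonal of `η = diag(1, 1, 1, 1, -1, -1)`. -/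
def ppSignature : Fin 6 → ℝ := ![1, 1, 1, 1, -1, -1]

/-- `(x, y, (Hu + u + v)/√2, (H - u²/2)/√2, (Hu - u + v)/√2, (H + u²/2)/√2)`; the products `Hu` and
`u²` are ordinary products of functions. -/
def ppEmbedding (H : MoyalAlgebra U θ) : Fin 6 → MoyalAlgebra U θ :=
  let x : MoyalAlgebra U θ := MoyalAlgebra.coord 0
  let y : MoyalAlgebra U θ := MoyalAlgebra.coord 1
  let u : MoyalAlgebra U θ := MoyalAlgebra.coord 2
  let v : MoyalAlgebra U θ := MoyalAlgebra.coord 3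
  ![x,
    y,
    (√2)⁻¹ • (MoyalAlgebra.pointwiseMul H u + u + v),
    (√2)⁻¹ • (H - (1 / 2 : ℝ) • MoyalAlgebra.pointwiseMul u u),
    (√2)⁻¹ • (MoyalAlgebra.pointwiseMul H u - u + v),
    (√2)⁻¹ • (H + (1 / 2 : ℝ) • MoyalAlgebra.pointwiseMul u u)]

/-- `H_xx + H_yy`. -/
def ppLaplacian (H : MoyalAlgebra U θ) : MoyalAlgebra U θ :=
  MoyalAlgebra.pderiv 0 (MoyalAlgebra.pderiv 0 H) + MoyalAlgebra.pderiv 1 (MoyalAlgebra.pderiv 1 H)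

/-- `H` does not depend on `v` and its embedding is a noncommutative space that solves the
noncommutative vacuum Einstein equation. -/
def IsPlaneFrontedWave (H : MoyalAlgebra U θ) : Prop :=
  MoyalAlgebra.pderiv 3 H = 0 ∧ IsNCSpace ppSignature (ppEmbedding H) ∧
    VacuumEinstein ppSignature (ppEmbedding H)

end PlaneFronted

end NCSpace

end

namespace NCSpace

open scoped TensorProduct
open TopologicalSpace Finset

/-! ### Leibniz rule and products with a coordinate, order by order in `ℏ` -/

section Abstract

variable {n : ℕ} {S : Type*} [CommRing S] [Algebra ℝ S]
  (θ : Matrix (Fin n) (Fin n) ℝ) (D : Fin n → Derivation ℝ S S)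

/-! The pointwise products in `X_H` always have a factor `u`, and for a coordinate `c` the pointwise
product is the symmetrised star product: `fc = ½(f*c + c*f)`. Order one in `ℏ` cancels by skewness
of `θ`, and higher orders vanish because the second derivatives of `c` do (`pointwiseMul_coord`).
With the star Leibniz rule `pderiv_mul`, everything becomes algebra in a noncommutative ring with
commuting derivations.

Differentiating `E e = E` and `e (ηEᵗ) = ηEᵗ` gives a Gauss equation (`riemann_eq`): the curvature
is the antisymmetrised pairing of the normal parts of the second derivatives of `X`, times the
inverse metric. No derivative of the inverse metric is needed.

In a null frame for `η`, the embedding is `(x, y, ½(H*u + u*H) + v, u, H, -½u*u)`. The metric is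
constant up to `2H` in position `uu` and the commutators `½(u*H_x - H_x*u)`, `½(u*H_y - H_y*u)` in
positions `xu`, `yu` (with opposite sign in `ux`, `uy`), so it has an explicit inverse, polynomial
in these entries. Its `xy` block is the identity, and in row and column `u` only the `uv` and `vu`
entries are nonzero.

Since `v`-derivatives of `H` vanish, these entries annihilate every term of the normal pairing that
involves `u`. Its only quadratic term, `H_x*H_x + H_y*H_y`, is symmetric in the two curvature
indices and cancels. The curvature is therefore built from second derivatives of `H`, and its traces
leave only `-(H_xx + H_yy)`. The Einstein equation becomes linear in `H`, whence additivity. -/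

theorem derivation_mul' (d : Derivation ℝ S S) (z : S ⊗[ℝ] S) :
    d (LinearMap.mul' ℝ S z) =
      LinearMap.mul' ℝ S ((d.toLinearMap.rTensor S + d.toLinearMap.lTensor S) z) := by
  induction z with
  | zero => simp
  | tmul a b => simp [mul_comm, add_comm]
  | add a b ha hb => simp only [map_add, ha, hb]

/-- The coefficients `θ i j` are constant and the derivations commute. This is what makes each `D k`
a derivation of the star product. -/
theorem commute_bidiff_tensor (hD : ∀ i j a, D i (D j a) = D j (D i a)) (k : Fin n) :
    Commute ((D k).toLinearMap.rTensor S + (D k).toLinearMap.lTensor S) (bidiff θ D) := by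
  refine Commute.sum_right _ _ _ fun i _ => Commute.sum_right _ _ _ fun j _ =>
    Commute.smul_right ?_ _
  change _ * _ = _ * _
  ext a b
  simp [hD k]

theorem derivation_moyalTerm (hD : ∀ i j a, D i (D j a) = D j (D i a)) (k : Fin n) (p : ℕ)
    (f g : S) : D k (moyalTerm θ D p f g) =
      moyalTerm θ D p (D k f) g + moyalTerm θ D p f (D k g) := by
  have h := congrArg (fun T : Module.End ℝ (S ⊗[ℝ] S) => LinearMap.mul' ℝ S (T (f ⊗ₜ g)))
    ((commute_bidiff_tensor θ D hD k).pow_right p)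
  simp only [Module.End.mul_apply] at h
  rw [moyalTerm_apply, Derivation.map_smul, derivation_mul', h]
  simp [moyalTerm_apply]

theorem derivation_moyalProd (hD : ∀ i j a, D i (D j a) = D j (D i a)) (k : Fin n)
    (f g : ℕ → S) (N : ℕ) : D k (moyalProd θ D f g N) =
      moyalProd θ D (fun q => D k (f q)) g N + moyalProd θ D f (fun q => D k (g q)) N := by
  simp only [moyalProd, map_sum, derivation_moyalTerm θ D hD, sum_add_distrib]

theorem moyalProd_single (f : ℕ → S) (g : S) (N : ℕ) :
    moyalProd θ D f (Pi.single 0 g) N =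
      ∑ x ∈ antidiagonal N, moyalTerm θ D x.1 (f x.2) g := by
  refine sum_congr rfl fun x _ => ?_
  rw [sum_eq_single (x.2, 0)]
  · simp
  · rintro ⟨a, b⟩ h h'
    have : b ≠ 0 := by rintro rfl; simp at h h'; omega
    simp [this]
  · simp

theorem single_moyalProd (f : ℕ → S) (g : S) (N : ℕ) :
    moyalProd θ D (Pi.single 0 g) f N =
      ∑ x ∈ antidiagonal N, moyalTerm θ D x.1 g (f x.2) := by
  refine sum_congr rfl fun x _ => ?_
  rw [sum_eq_single (0, x.2)]
  · simp
  · rintro ⟨a, b⟩ h h'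
    have : a ≠ 0 := by rintro rfl; simp at h h'; omega
    simp [this]
  · simp

variable {θ D} {c : S} {k : Fin n}

theorem bidiff_tmul_coord (hc : ∀ i, D i c = if i = k then 1 else 0) (f : S) :
    bidiff θ D (f ⊗ₜ c) = (∑ i, θ i k • D i f) ⊗ₜ 1 := by
  simp [bidiff, hc, TensorProduct.tmul_ite, TensorProduct.sum_tmul, TensorProduct.smul_tmul']

theorem bidiff_coord_tmul (hc : ∀ i, D i c = if i = k then 1 else 0) (f : S) :
    bidiff θ D (c ⊗ₜ f) = 1 ⊗ₜ (∑ i, θ k i • D i f) := by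
  simp [bidiff, hc, TensorProduct.ite_tmul, TensorProduct.tmul_sum]

/-- One application of the bidifferential operator turns the factor `c` into the constant `1`, and a
second one kills it. Only orders zero and one remain. -/
theorem moyalTerm_coord_symm (hθ : θ.transpose = -θ)
    (hc : ∀ i, D i c = if i = k then 1 else 0) (p : ℕ) (f : S) :
    moyalTerm θ D p f c + moyalTerm θ D p c f = if p = 0 then 2 * (f * c) else 0 := by
  obtain _ | _ | p := p
  · simp only [moyalTerm_zero, if_true]; ring
  -- The two first-order terms are `∑ i, θ i k ∂ᵢf` and `∑ i, θ k i ∂ᵢf`, which are opposite by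
  -- skewness.
  · have h : ∀ i, θ k i = -θ i k := fun i => congrFun (congrFun hθ i) k
    simp [moyalTerm_apply, bidiff_tmul_coord hc, bidiff_coord_tmul hc, h]
  · have h1 : ∀ w : S, bidiff θ D (w ⊗ₜ 1) = 0 := by simp [bidiff]
    have h2 : ∀ w : S, bidiff θ D (1 ⊗ₜ w) = 0 := by simp [bidiff]
    simp [moyalTerm_apply, pow_succ, bidiff_tmul_coord hc, bidiff_coord_tmul hc, h1, h2]

theorem moyalProd_coord_symm (hθ : θ.transpose = -θ)
    (hc : ∀ i, D i c = if i = k then 1 else 0) (f : ℕ → S) (N : ℕ) :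
    moyalProd θ D f (Pi.single 0 c) N + moyalProd θ D (Pi.single 0 c) f N =
      (2 : ℝ) • ∑ x ∈ antidiagonal N, f x.1 * (Pi.single 0 c : ℕ → S) x.2 := by
  rw [moyalProd_single, single_moyalProd, ← sum_add_distrib]
  simp only [moyalTerm_coord_symm hθ hc]
  rw [sum_eq_single (0, N), sum_eq_single (N, 0)]
  · simp [two_smul, two_mul]
  · rintro ⟨a, b⟩ h h'
    have : b ≠ 0 := by rintro rfl; simp at h h'; omega
    simp [this]
  · simp
  · rintro ⟨a, b⟩ h h'
    have : a ≠ 0 := by rintro rfl; simp at h h'; omega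
    simp [this]
  · simp

end Abstract

/-! ### Calculus in the Moyal algebra -/

namespace MoyalAlgebra

variable {n : ℕ} {U : Opens (Fin n → ℝ)} {θ : Matrix (Fin n) (Fin n) ℝ}

instance : IsScalarTower ℝ (MoyalAlgebra U θ) (MoyalAlgebra U θ) where
  smul_assoc r f g := funext fun N => by
    change moyalProd θ SmoothFun.pderiv (fun q => r • f q) g N =
      r • moyalProd θ SmoothFun.pderiv f g N
    simp [moyalProd, smul_sum]

instance : SMulCommClass ℝ (MoyalAlgebra U θ) (MoyalAlgebra U θ) where
  smul_comm r f g := funext fun N => by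
    change r • moyalProd θ SmoothFun.pderiv f g N =
      moyalProd θ SmoothFun.pderiv f (fun q => r • g q) N
    simp [moyalProd, smul_sum]

theorem pderiv_mul (i : Fin n) (f g : MoyalAlgebra U θ) :
    pderiv i (f * g) = pderiv i f * g + f * pderiv i g :=
  funext fun N =>
    derivation_moyalProd θ SmoothFun.pderiv (SmoothFun.pderiv_comm (U := U)) i f g N

theorem pderiv_comm (i j : Fin n) (f : MoyalAlgebra U θ) :
    pderiv i (pderiv j f) = pderiv j (pderiv i f) :=
  funext fun N => SmoothFun.pderiv_comm i j (f N)

theorem smoothFun_pderiv_coord (i k : Fin n) :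
    SmoothFun.pderiv i (SmoothFun.coord U k) = if i = k then 1 else 0 := by
  refine Subtype.ext <| funext fun t => ?_
  rw [SmoothFun.pderiv_apply, (SmoothFun.hasFDerivAt_of_eq (F := fun t => t k) (fun s => rfl)
    (hasFDerivAt_apply k t.1)).fderiv]
  by_cases h : i = k
  · subst h; simp
  · simp [h, Ne.symm h]

theorem pderiv_one (i : Fin n) : pderiv i (1 : MoyalAlgebra U θ) = 0 := by
  have h := pderiv_mul i (1 : MoyalAlgebra U θ) 1
  simpa using h

theorem pderiv_coord (i k : Fin n) :
    pderiv i (coord k : MoyalAlgebra U θ) = if i = k then 1 else 0 := by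
  funext N
  change SmoothFun.pderiv i ((Pi.single 0 (SmoothFun.coord U k) : ℕ → SmoothFun U) N) = _
  obtain _ | N := N
  · rw [Pi.single_eq_same, smoothFun_pderiv_coord]
    split_ifs <;> rfl
  · rw [Pi.single_eq_of_ne (by simp), map_zero]
    split_ifs <;> rfl

theorem mul_coord_add_coord_mul (hθ : θ.transpose = -θ) (k : Fin n) (f : MoyalAlgebra U θ) :
    f * coord k + coord k * f = (2 : ℝ) • pointwiseMul f (coord k) := by
  exact funext fun N => moyalProd_coord_symm hθ (fun i => smoothFun_pderiv_coord i k) f N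

/-- Removes the pointwise product from the embedding, leaving only operations of the star ring. -/
theorem pointwiseMul_coord (hθ : θ.transpose = -θ) (k : Fin n) (f : MoyalAlgebra U θ) :
    pointwiseMul f (coord k) = (1 / 2 : ℝ) • (f * coord k + coord k * f) := by
  rw [mul_coord_add_coord_mul hθ, smul_smul]; norm_num

end MoyalAlgebra

/-! ### Gauss equation for an embedded noncommutative space -/

section Curvature

open MoyalAlgebra

variable {n m : ℕ} {U : Opens (Fin n → ℝ)} {θ : Matrix (Fin n) (Fin n) ℝ}

theorem map_pderiv_mul {k l r : ℕ} (i : Fin n) (A : Matrix (Fin k) (Fin l) (MoyalAlgebra U θ))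
    (B : Matrix (Fin l) (Fin r) (MoyalAlgebra U θ)) :
    (A * B).map (pderiv i) = A.map (pderiv i) * B + A * B.map (pderiv i) := by
  ext a b
  simp [Matrix.mul_apply, pderiv_mul, sum_add_distrib]

variable {η : Fin m → ℝ} {X : Fin m → MoyalAlgebra U θ}

theorem frame_mul_dualFrame (h : IsNCSpace η X) : frame X * dualFrame η X = 1 := by
  rw [dualFrame, ← Matrix.mul_assoc]
  exact Ring.mul_inverse_cancel _ h

theorem frame_mul_idempotent (h : IsNCSpace η X) : frame X * idempotent η X = frame X := by
  rw [idempotent, ← Matrix.mul_assoc, frame_mul_dualFrame h, Matrix.one_mul]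

theorem idempotent_mul_dualFrame (h : IsNCSpace η X) :
    idempotent η X * dualFrame η X = dualFrame η X := by
  rw [idempotent, Matrix.mul_assoc, frame_mul_dualFrame h, Matrix.mul_one]

theorem idempotent_mul_frameT (h : IsNCSpace η X) :
    idempotent η X * frameT η X = frameT η X := by
  rw [idempotent, Matrix.mul_assoc, dualFrame, Matrix.mul_assoc]
  change frameT η X * (Ring.inverse (metric η X) * metric η X) = _
  rw [Ring.inverse_mul_cancel _ h, Matrix.mul_one]

/-- Leibniz rule applied to `E * e = E`. -/
theorem frame_mul_map_idempotent (h : IsNCSpace η X) (i : Fin n) :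
    frame X * (idempotent η X).map (pderiv i) =
      (frame X).map (pderiv i) * (1 - idempotent η X) := by
  have := map_pderiv_mul i (frame X) (idempotent η X)
  rw [frame_mul_idempotent h] at this
  rw [Matrix.mul_sub, Matrix.mul_one, eq_sub_iff_add_eq']
  exact this.symm

/-- Leibniz rule applied to `e * ηEᵗ = ηEᵗ`. Working with `ηEᵗ` rather than `Ẽ` keeps the inverse
metric outside the derivative. -/
theorem map_idempotent_mul_dualFrame (h : IsNCSpace η X) (i : Fin n) :
    (idempotent η X).map (pderiv i) * dualFrame η X =
      (1 - idempotent η X) * (frameT η X).map (pderiv i) * invMetric η X := by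
  have h1 := map_pderiv_mul i (idempotent η X) (frameT η X)
  rw [idempotent_mul_frameT h] at h1
  rw [dualFrame, ← Matrix.mul_assoc, Matrix.sub_mul, Matrix.one_mul, eq_sub_of_add_eq h1.symm]

/-- The second derivatives of `e` cancel because partial derivatives commute, so only the commutator
of connection matrices survives. -/
theorem curvature_eq (i j : Fin n) : curvature η X i j =
    (idempotent η X).map (pderiv j) * (idempotent η X).map (pderiv i) -
      (idempotent η X).map (pderiv i) * (idempotent η X).map (pderiv j) := by
  have h : (connection η X j).map (pderiv i) = (connection η X i).map (pderiv j) := by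
    ext a b
    simp [connection, pderiv_comm i j]
  rw [curvature, h]
  simp [connection]

/-- The pairing `∂ᵢE * (1 - e) * ∂ⱼ(η Eᵗ)` of the normal parts of the second derivatives. -/
noncomputable def normalPairing (η : Fin m → ℝ) (X : Fin m → MoyalAlgebra U θ) (i j : Fin n) :
    Matrix (Fin n) (Fin n) (MoyalAlgebra U θ) :=
  (frame X).map (pderiv i) * (frameT η X).map (pderiv j) -
    ((frame X).map (pderiv i) * frameT η X) * invMetric η X *
      (frame X * (frameT η X).map (pderiv j))

/-- The Gauss equation. -/
theorem riemann_eq (h : IsNCSpace η X) (l k i j : Fin n) : riemann η X l k i j =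
    ((normalPairing η X j i - normalPairing η X i j) * invMetric η X) k l := by
  -- Each outer factor turns its neighbouring `∂e` into a second derivative of `X` cut by `1 - e`;
  -- the two projections merge by idempotency.
  have key : ∀ i j, frame X * ((idempotent η X).map (pderiv i) *
      (idempotent η X).map (pderiv j)) * dualFrame η X =
      normalPairing η X i j * invMetric η X := by
    intro i j
    have h2 : (1 - idempotent η X) * (1 - idempotent η X) = 1 - idempotent η X := by
      have : idempotent η X * idempotent η X = idempotent η X := by
        nth_rw 2 [idempotent]
        rw [← Matrix.mul_assoc, idempotent_mul_dualFrame h, ← idempotent]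
      noncomm_ring [this]
    calc _ = (frame X * (idempotent η X).map (pderiv i)) *
          ((idempotent η X).map (pderiv j) * dualFrame η X) := by simp only [Matrix.mul_assoc]
      _ = (frame X).map (pderiv i) * ((1 - idempotent η X) * (1 - idempotent η X)) *
          ((frameT η X).map (pderiv j)) * invMetric η X := by
        rw [frame_mul_map_idempotent h, map_idempotent_mul_dualFrame h]
        simp only [Matrix.mul_assoc]
      _ = _ := by
        rw [h2, normalPairing, Matrix.mul_sub, Matrix.sub_mul, Matrix.mul_one, idempotent,
          dualFrame]
        simp only [Matrix.mul_assoc]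
  rw [riemann, curvature_eq, Matrix.mul_sub, Matrix.sub_mul, key, key, Matrix.sub_mul]

end Curvature

/-! ### The embedding in a null frame -/

section PlaneFronted

open MoyalAlgebra TopologicalSpace Finset

variable {U : Opens (Fin 4 → ℝ)} {θ : Matrix (Fin 4) (Fin 4) ℝ}

/-- The vector whose components in the null frame of `ppSignature` are `a`. -/
noncomputable def nullVec (a : Fin 6 → MoyalAlgebra U θ) : Fin 6 → MoyalAlgebra U θ :=
  ![a 0, a 1, (√2)⁻¹ • (a 2 + a 3), (√2)⁻¹ • (a 4 + a 5), (√2)⁻¹ • (a 2 - a 3),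
    (√2)⁻¹ • (a 4 - a 5)]

theorem pderiv_nullVec (i : Fin 4) (a : Fin 6 → MoyalAlgebra U θ) (α : Fin 6) :
    pderiv i (nullVec a α) = nullVec (fun β => pderiv i (a β)) α := by
  fin_cases α <;> simp [nullVec]

/-- Each pair of opposite signs contributes `½((a + a')(b + b') - (a - a')(b - b')) = a b' + a' b`,
an identity that keeps the order of the factors. -/
theorem sum_nullVec_mul (a b : Fin 6 → MoyalAlgebra U θ) :
    ∑ α, nullVec a α * ppSignature α • nullVec b α =
      a 0 * b 0 + a 1 * b 1 + a 2 * b 3 + a 3 * b 2 + a 4 * b 5 + a 5 * b 4 := by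
  have h : (√2)⁻¹ * (√2)⁻¹ = (1 / 2 : ℝ) := by
    rw [← mul_inv, Real.mul_self_sqrt (by norm_num)]; norm_num
  simp only [nullVec, ppSignature, Fin.sum_univ_six, Matrix.cons_val, smul_mul_assoc,
    mul_smul_comm, smul_smul, h]
  simp only [add_mul, mul_add, sub_mul, mul_sub]
  module

/-- The components of `ppEmbedding H` in the null frame. -/
noncomputable def ppNull (H : MoyalAlgebra U θ) : Fin 6 → MoyalAlgebra U θ :=
  ![coord 0, coord 1, (1 / 2 : ℝ) • (H * coord 2 + coord 2 * H) + coord 3, coord 2, H,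
    -((1 / 2 : ℝ) • (coord 2 * coord 2))]

theorem ppEmbedding_eq (hθ : θ.transpose = -θ) (H : MoyalAlgebra U θ) :
    ppEmbedding H = nullVec (ppNull H) := by
  have h : (1 / 2 : ℝ) • (coord 2 * coord 2 + coord 2 * coord 2 : MoyalAlgebra U θ) =
      coord 2 * coord 2 := by
    rw [← two_smul ℝ, smul_smul]; norm_num
  funext α
  simp only [ppEmbedding, pointwiseMul_coord hθ, h]
  fin_cases α <;> simp only [nullVec, ppNull, Matrix.cons_val, Fin.reduceFinMk, Fin.zero_eta,
    Fin.mk_one] <;> congr 1 <;> abel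

theorem pderiv_ite (i : Fin 4) (p : Prop) [Decidable p] :
    pderiv i (if p then (1 : MoyalAlgebra U θ) else 0) = 0 := by
  split_ifs <;> simp [pderiv_one]

theorem pderiv_ppNull (H : MoyalAlgebra U θ) (i : Fin 4) (α : Fin 6) :
    pderiv i (ppNull H α) =
      ![if i = 0 then 1 else 0, if i = 1 then 1 else 0,
        (1 / 2 : ℝ) • (pderiv i H * coord 2 + coord 2 * pderiv i H) +
          (if i = 2 then 1 else 0) * H + (if i = 3 then 1 else 0),
        if i = 2 then 1 else 0, pderiv i H, -((if i = 2 then 1 else 0) * coord 2)] α := by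
  fin_cases α <;> simp only [ppNull, Matrix.cons_val, Fin.reduceFinMk, Fin.zero_eta,
    Fin.mk_one, pderiv_coord, map_add, map_neg, map_smul, pderiv_mul]
  · by_cases h2 : i = 2 <;>
      simp only [h2, if_true, if_false, mul_one, one_mul, mul_zero, zero_mul] <;> module
  · split_ifs <;> simp only [mul_one, one_mul, mul_zero, zero_mul] <;> module

theorem pderiv_pderiv_ppNull (H : MoyalAlgebra U θ) (i k : Fin 4) (α : Fin 6) :
    pderiv i (pderiv k (ppNull H α)) =
      ![0, 0, (1 / 2 : ℝ) • (pderiv i (pderiv k H) * coord 2 + coord 2 * pderiv i (pderiv k H)) +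
          (if i = 2 then 1 else 0) * pderiv k H + (if k = 2 then 1 else 0) * pderiv i H,
        0, pderiv i (pderiv k H), -((if i = 2 then 1 else 0) * (if k = 2 then 1 else 0))] α := by
  rw [pderiv_ppNull]
  fin_cases α <;> simp only [Matrix.cons_val, Fin.reduceFinMk, Fin.zero_eta,
    Fin.mk_one, pderiv_coord, map_add, map_neg, map_smul, pderiv_mul, pderiv_ite, zero_mul,
    zero_add, add_zero]
  · by_cases h2 : i = 2 <;>
      simp only [h2, if_true, if_false, mul_one, one_mul, mul_zero, zero_mul] <;> module
  · split_ifs <;> simp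

theorem frame_apply (X : Fin 6 → MoyalAlgebra U θ) (i : Fin 4) (α : Fin 6) :
    frame X i α = pderiv i (X α) := rfl

theorem frameT_apply (η : Fin 6 → ℝ) (X : Fin 6 → MoyalAlgebra U θ) (i : Fin 4) (α : Fin 6) :
    frameT η X α i = η α • pderiv i (X α) := rfl

/-- The inverse of the metric of `ppEmbedding H`, where `a` and `b` are the components
`g_{xu}` and `g_{yu}` and `c` is the component `g_{uu}`. -/
noncomputable def ppInvMetric (a b c : MoyalAlgebra U θ) : Matrix (Fin 4) (Fin 4) (MoyalAlgebra U θ) :=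
  !![1, 0, 0, -a; 0, 1, 0, -b; 0, 0, 0, 1; a, b, 1, -(c + a * a + b * b)]

/-- No commutation is needed: `a` and `b` meet only themselves and `c` meets only constants. Over a
noncommutative ring the inverse is checked on both sides. -/
theorem mul_ppInvMetric (a b c : MoyalAlgebra U θ) :
    !![1, 0, a, 0; 0, 1, b, 0; -a, -b, c, 1; 0, 0, 1, 0] * ppInvMetric a b c = 1 := by
  ext i j
  fin_cases i <;> fin_cases j <;> simp [ppInvMetric, Matrix.mul_apply, Fin.sum_univ_four]
  abel

theorem ppInvMetric_mul (a b c : MoyalAlgebra U θ) :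
    ppInvMetric a b c * !![1, 0, a, 0; 0, 1, b, 0; -a, -b, c, 1; 0, 0, 1, 0] = 1 := by
  ext i j
  fin_cases i <;> fin_cases j <;> simp [ppInvMetric, Matrix.mul_apply, Fin.sum_univ_four]
  abel

/-! ### Metric and curvature of the plane-fronted embedding -/

section

variable (hθ : θ.transpose = -θ) {H : MoyalAlgebra U θ} (hH : pderiv 3 H = 0)

/-- The component `½ (u * f - f * u)` by which the pointwise product with `u` exceeds the star
product. -/
noncomputable def uDefect (f : MoyalAlgebra U θ) : MoyalAlgebra U θ :=
  (1 / 2 : ℝ) • (coord 2 * f - f * coord 2)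

include hθ hH

theorem metric_ppEmbedding : metric ppSignature (ppEmbedding H) =
    !![1, 0, uDefect (pderiv 0 H), 0; 0, 1, uDefect (pderiv 1 H), 0;
      -uDefect (pderiv 0 H), -uDefect (pderiv 1 H), 2 * H, 1; 0, 0, 1, 0] := by
  ext i j
  rw [ppEmbedding_eq hθ, metric, Matrix.mul_apply]
  simp only [frame_apply, frameT_apply, pderiv_nullVec, sum_nullVec_mul, pderiv_ppNull]
  fin_cases i <;> fin_cases j <;> simp [hH, uDefect, two_mul] <;>
    module

theorem isNCSpace_ppEmbedding : IsNCSpace ppSignature (ppEmbedding H) := by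
  rw [IsNCSpace, metric_ppEmbedding hθ hH]
  exact ⟨⟨_, _, mul_ppInvMetric _ _ _, ppInvMetric_mul _ _ _⟩, rfl⟩

theorem invMetric_ppEmbedding : invMetric ppSignature (ppEmbedding H) =
    ppInvMetric (uDefect (pderiv 0 H)) (uDefect (pderiv 1 H)) (2 * H) := by
  rw [invMetric, metric_ppEmbedding hθ hH]
  exact Ring.inverse_unit ⟨_, _, mul_ppInvMetric _ _ _, ppInvMetric_mul _ _ _⟩

/-- The terms containing `u` sit at frame index `u` of the tangential part. The inverse metric joins
index `u` only to `v`, where the other factor vanishes because `∂ᵥH = 0`. The block `x, y`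
contributes the quadratic term. -/
theorem normalPairing_ppEmbedding (i j k m : Fin 4) :
    normalPairing ppSignature (ppEmbedding H) i j k m =
      -(pderiv i (pderiv k H) * ((if j = 2 then 1 else 0) * if m = 2 then 1 else 0)) -
        ((if i = 2 then 1 else 0) * if k = 2 then 1 else 0) * pderiv j (pderiv m H) -
        ((if i = 2 then 1 else 0) * if k = 2 then 1 else 0) *
          ((if j = 2 then 1 else 0) * if m = 2 then 1 else 0) *
          (pderiv 0 H * pderiv 0 H + pderiv 1 H * pderiv 1 H) := by
  have h1 : ∀ q, ((frame (ppEmbedding H)).map (pderiv i) *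
      frameT ppSignature (ppEmbedding H)) k q =
      ((1 / 2 : ℝ) • (pderiv i (pderiv k H) * coord 2 + coord 2 * pderiv i (pderiv k H)) +
        (if i = 2 then 1 else 0) * pderiv k H + (if k = 2 then 1 else 0) * pderiv i H) *
        (if q = 2 then 1 else 0) - pderiv i (pderiv k H) * ((if q = 2 then 1 else 0) * coord 2) -
        ((if i = 2 then 1 else 0) * (if k = 2 then 1 else 0)) * pderiv q H := fun q => by
    rw [ppEmbedding_eq hθ, Matrix.mul_apply]
    simp only [frame_apply, frameT_apply, Matrix.map_apply, pderiv_nullVec, sum_nullVec_mul,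
      pderiv_pderiv_ppNull]
    simp only [pderiv_ppNull, Matrix.cons_val]
    simp only [sub_eq_add_neg, mul_neg, neg_mul, zero_mul, add_zero, zero_add, mul_assoc]
  have h2 : ∀ q, (frame (ppEmbedding H) *
      (frameT ppSignature (ppEmbedding H)).map (pderiv j)) q m =
      (if q = 2 then 1 else 0) *
      ((1 / 2 : ℝ) • (pderiv j (pderiv m H) * coord 2 + coord 2 * pderiv j (pderiv m H)) +
        (if j = 2 then 1 else 0) * pderiv m H + (if m = 2 then 1 else 0) * pderiv j H) -
        (if q = 2 then 1 else 0) * coord 2 * pderiv j (pderiv m H) -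
        pderiv q H * ((if j = 2 then 1 else 0) * (if m = 2 then 1 else 0)) := fun q => by
    rw [ppEmbedding_eq hθ, Matrix.mul_apply]
    simp only [frame_apply, frameT_apply, Matrix.map_apply, map_smul, pderiv_nullVec,
      sum_nullVec_mul, pderiv_pderiv_ppNull]
    simp only [pderiv_ppNull, Matrix.cons_val]
    simp only [sub_eq_add_neg, mul_neg, neg_mul, mul_zero, add_zero, zero_add, mul_assoc]
    abel
  -- The null component holding `½(H*u + u*H) + v` pairs with that of `u`, whose second derivatives
  -- are zero; only the pairing of `H` with `-½u*u` is left.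
  have h3 : ((frame (ppEmbedding H)).map (pderiv i) *
      (frameT ppSignature (ppEmbedding H)).map (pderiv j)) k m =
      -(pderiv i (pderiv k H) * ((if j = 2 then 1 else 0) * if m = 2 then 1 else 0)) -
        ((if i = 2 then 1 else 0) * if k = 2 then 1 else 0) * pderiv j (pderiv m H) := by
    rw [ppEmbedding_eq hθ, Matrix.mul_apply]
    simp only [frame_apply, frameT_apply, Matrix.map_apply, map_smul, pderiv_nullVec,
      sum_nullVec_mul, pderiv_pderiv_ppNull, Matrix.cons_val]
    simp only [sub_eq_add_neg, mul_neg, neg_mul, mul_zero, zero_mul, add_zero, zero_add, mul_assoc]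
  rw [normalPairing, Matrix.sub_apply, h3, Matrix.mul_apply]
  have h4 : ∀ q, ((frame (ppEmbedding H)).map (pderiv i) * frameT ppSignature (ppEmbedding H) *
      invMetric ppSignature (ppEmbedding H)) k q = _ := fun q => Matrix.mul_apply
  simp only [h4, h1, h2, Fin.sum_univ_four]
  simp only [invMetric_ppEmbedding hθ hH]
  simp [ppInvMetric, hH]
  split_ifs <;> simp

theorem riemann_ppEmbedding (l k i j : Fin 4) :
    riemann ppSignature (ppEmbedding H) l k i j =
      ∑ m, (pderiv i (pderiv k H) * ((if j = 2 then 1 else 0) * if m = 2 then 1 else 0) +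
        ((if i = 2 then 1 else 0) * if k = 2 then 1 else 0) * pderiv j (pderiv m H) -
        pderiv j (pderiv k H) * ((if i = 2 then 1 else 0) * if m = 2 then 1 else 0) -
        ((if j = 2 then 1 else 0) * if k = 2 then 1 else 0) * pderiv i (pderiv m H)) *
        ppInvMetric (uDefect (pderiv 0 H)) (uDefect (pderiv 1 H)) (2 * H) m l := by
  rw [riemann_eq (isNCSpace_ppEmbedding hθ hH), Matrix.mul_apply]
  refine sum_congr rfl fun m _ => ?_
  rw [Matrix.sub_apply, normalPairing_ppEmbedding hθ hH, normalPairing_ppEmbedding hθ hH,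
    invMetric_ppEmbedding hθ hH]
  congr 1
  -- The quadratic term is unchanged by exchanging `i` and `j`, so it drops out of the difference.
  split_ifs <;> simp <;> abel

/-- Three of the four curvature terms trace to `v`-derivatives of `H`. The last is contracted with
the inverse metric, whose block `x, y` is the identity, and gives the Laplacian. -/
theorem ricci_ppEmbedding (i j : Fin 4) : ricci ppSignature (ppEmbedding H) i j =
    if i = 2 ∧ j = 2 then -ppLaplacian H else 0 := by
  have h3 : ∀ k, pderiv 3 (pderiv k H) = 0 := fun k => by rw [pderiv_comm, hH, map_zero]
  simp only [ricci, riemann_ppEmbedding hθ hH, Fin.sum_univ_four]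
  fin_cases i <;> fin_cases j <;> simp [ppInvMetric, hH, h3, ppLaplacian]
  all_goals abel

theorem ricciMixed_ppEmbedding (i j : Fin 4) : ricciMixed ppSignature (ppEmbedding H) i j =
    if i = 3 ∧ j = 2 then -ppLaplacian H else 0 := by
  simp only [ricciMixed, ricci_ppEmbedding hθ hH, invMetric_ppEmbedding hθ hH, Fin.sum_univ_four]
  fin_cases i <;> simp [ppInvMetric]

/-- The Ricci curvature has only a `uu` component, and the `uu` entry of the inverse metric is zero.
-/
theorem scalarCurvature_ppEmbedding : scalarCurvature ppSignature (ppEmbedding H) = 0 := by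
  simp [scalarCurvature, ricci_ppEmbedding hθ hH, invMetric_ppEmbedding hθ hH, Fin.sum_univ_four,
    ppInvMetric]

theorem thetaMixed_ppEmbedding (l p : Fin 4) : thetaMixed ppSignature (ppEmbedding H) l p =
    if l = 3 ∧ p = 2 then -ppLaplacian H else 0 := by
  have h3 : ∀ k, pderiv 3 (pderiv k H) = 0 := fun k => by rw [pderiv_comm, hH, map_zero]
  simp only [thetaMixed, riemann_ppEmbedding hθ hH, invMetric_ppEmbedding hθ hH,
    Fin.sum_univ_four]
  fin_cases l <;> fin_cases p <;> simp [ppInvMetric, hH, h3, ppLaplacian]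
  all_goals abel

theorem vacuumEinstein_ppEmbedding_iff :
    VacuumEinstein ppSignature (ppEmbedding H) ↔ ppLaplacian H = 0 := by
  simp only [VacuumEinstein, ricciMixed_ppEmbedding hθ hH, thetaMixed_ppEmbedding hθ hH,
    scalarCurvature_ppEmbedding hθ hH, ite_self, sub_zero]
  refine ⟨fun h => ?_, fun h i j => by simp [h]⟩
  have h2 : (2 : ℝ) • ppLaplacian H = 0 := by
    -- In position `(v, u)` Ricci and `Θ` contribute equally, so the equation says that twice the
    -- Laplacian vanishes.
    have := h 3 2
    rw [if_pos ⟨rfl, rfl⟩, ← neg_add, neg_eq_zero] at this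
    rw [two_smul, this]
  exact (smul_eq_zero.1 h2).resolve_left two_ne_zero

end

end PlaneFronted

end NCSpace

theorem mainTheorem9 (U : TopologicalSpace.Opens (Fin 4 → ℝ)) (θ : Matrix (Fin 4) (Fin 4) ℝ)
    (hθ : θ.transpose = -θ) :
    (∀ H : NCSpace.MoyalAlgebra U θ, NCSpace.MoyalAlgebra.pderiv 3 H = 0 →
      NCSpace.IsNCSpace NCSpace.ppSignature (NCSpace.ppEmbedding H) ∧
      (∀ i j : Fin 4, NCSpace.ricciMixed NCSpace.ppSignature (NCSpace.ppEmbedding H) i j =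
        if i = 3 ∧ j = 2 then -NCSpace.ppLaplacian H else 0) ∧
      (∀ i j : Fin 4, NCSpace.thetaMixed NCSpace.ppSignature (NCSpace.ppEmbedding H) i j =
        if i = 3 ∧ j = 2 then -NCSpace.ppLaplacian H else 0) ∧
      (NCSpace.VacuumEinstein NCSpace.ppSignature (NCSpace.ppEmbedding H) ↔
        NCSpace.ppLaplacian H = 0)) ∧
    (∀ H₁ H₂ : NCSpace.MoyalAlgebra U θ,
      NCSpace.IsPlaneFrontedWave H₁ → NCSpace.IsPlaneFrontedWave H₂ →
        NCSpace.IsPlaneFrontedWave (H₁ + H₂)) := by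
  refine ⟨fun H hH => ⟨NCSpace.isNCSpace_ppEmbedding hθ hH, NCSpace.ricciMixed_ppEmbedding hθ hH,
    NCSpace.thetaMixed_ppEmbedding hθ hH, NCSpace.vacuumEinstein_ppEmbedding_iff hθ hH⟩,
    fun H₁ H₂ ⟨h₁, _, e₁⟩ ⟨h₂, _, e₂⟩ => ?_⟩
  have h : NCSpace.MoyalAlgebra.pderiv 3 (H₁ + H₂) = 0 := by rw [map_add, h₁, h₂, add_zero]
  refine ⟨h, NCSpace.isNCSpace_ppEmbedding hθ h, ?_⟩
  rw [NCSpace.vacuumEinstein_ppEmbedding_iff hθ h₁] at e₁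
  rw [NCSpace.vacuumEinstein_ppEmbedding_iff hθ h₂] at e₂
  rw [NCSpace.vacuumEinstein_ppEmbedding_iff hθ h]
  calc NCSpace.ppLaplacian (H₁ + H₂) = NCSpace.ppLaplacian H₁ + NCSpace.ppLaplacian H₂ := by
        simp only [NCSpace.ppLaplacian, map_add]; abel
    _ = 0 := by rw [e₁, e₂, add_zero]
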